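/- Setting. There are $K\ge 2$ arms, embedded at distinct known points $x(1),\dots,x(K)\in[0,1]^D$; write $\Delta_x=\min_{i\ne j}\|x(i)-x(j)\|$. For $L>0$ let $\Phi(L)$ be the set of mean-reward vectors $\mu\in[0,1]^K$ with $|\mu(i)-\mu(j)|\le L\|x(i)-x(j)\|$ for all $i,j$. For every $T$ one observes $M=M_T$ past episodes, each of $T$ rounds: in each round an arm is pulled, and pulling arm $i$ in episode $m$ gives an independent Bernoulli reward of mean $\mu_m(i)$. Let $L_m=\max_{i\ne j}|\mu_m(i)-\mu_m(j)|/\|x(i)-x(j)\|$. An estimator $\hat L$ is, for each $T$, a real function of the pulled arms and rewards in the $M_T$ episodes. Let $0<\alpha\le 1$, $0<\varepsilon_\alpha<\varepsilon$ and let $\tau=\tau_T$ be positive integers, constant or depending on $T$, with $K\tau_T\le T$ for all large $T$. The estimator $\hat L$ is called uniformly good for $(\alpha,\varepsilon_\alpha,\tau,\varepsilon)$ if $$\Pr[\hat L>L+\varepsilon]+\Pr[\hat L<L]=o\!\left(\frac{\log T}{T}\right)\qquad(T\to\infty)$$ for every $L>0$, every sequence of tasks $\mu_1,\mu_2,\dots\in\Phi(L)$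 (the first $M_T$ of which are observed) and all choices of the pulled arms such that, for all large $T$: (1) $|\{m\le M_T: L_m\ge L-\varepsilon_\alpha\}|\ge\alpha M_T$; (2) in each of the $M_T$ episodes every arm is pulled at least $\tau_T$ times. Theorem. For every $\eta_0<1$ there is a constant $c>0$, depending only on $\eta_0$, such that whenever $(\varepsilon-\varepsilon_\alpha)\Delta_x\le\eta_0$ and $\hat L$ is uniformly good for $(\alpha,\varepsilon_\alpha,\tau,\varepsilon)$, then for all sufficiently large $T$ $$\Delta_x^2(\varepsilon-\varepsilon_\alpha)^2\,\alpha\,\tau\,M\ \ge\ c\log T,$$ provided that $\tau$ is constant (or just bounded in $T$), or that $\alpha M_T\ge1$ for all large $T$. With no such proviso the same holds with $c\,\alpha$ in place of $c$. In short, $\Delta_x^2(\varepsilon-\varepsilon_\alpha)^2\alpha\tau M=\Omega(\log T)$. -/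

import Mathlib

open MeasureTheory Filter

namespace LipschitzTransfer

/-- The Lipschitz structure `Φ(L)` of Bernoulli bandit instances (vectors of mean rewards in
`[0,1]`) over the arms `1, …, K` embedded at the points `x 1, …, x K` of `ℝ^D`. -/
def lipStructure {D K : ℕ} (x : Fin K → EuclideanSpace ℝ (Fin D)) (L : ℝ) :
    Set (Fin K → unitInterval) :=
  {μ | ∀ i j, |(μ i : ℝ) - (μ j : ℝ)| ≤ L * ‖x i - x j‖}

/-- The tightest Lipschitz constant `max_{i ≠ j} |μ(i) - μ(j)| / ‖x(i) - x(j)‖` of an instance. -/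
noncomputable def tightLip {D K : ℕ} (x : Fin K → EuclideanSpace ℝ (Fin D))
    (μ : Fin K → unitInterval) : ℝ :=
  ⨆ p : {p : Fin K × Fin K // p.1 ≠ p.2},
    |(μ p.1.1 : ℝ) - (μ p.1.2 : ℝ)| / ‖x p.1.1 - x p.1.2‖

/-- `Δ_x = min_{i ≠ j} ‖x(i) - x(j)‖`. -/
noncomputable def minDist {D K : ℕ} (x : Fin K → EuclideanSpace ℝ (Fin D)) : ℝ :=
  ⨅ p : {p : Fin K × Fin K // p.1 ≠ p.2}, ‖x p.1.1 - x p.1.2‖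

/-- Learnability: at least an `α`-portion of the `M` episodes have `L_m ≥ L - ε_α`. -/
def Learnable {D K M : ℕ} (x : Fin K → EuclideanSpace ℝ (Fin D)) (α εα L : ℝ)
    (μ : Fin M → Fin K → unitInterval) : Prop :=
  α * (M : ℝ) ≤ (Nat.card {m : Fin M // L - εα ≤ tightLip x (μ m)} : ℝ)

/-- Minimal exploration: in each of the `M` episodes of length `T`, every arm is pulled at least
`τ` times; `a m t` is the arm pulled in round `t` of episode `m`. -/
def MinExploration {K M T : ℕ} (τ : ℕ) (a : Fin M → Fin T → Fin K) : Prop :=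
  ∀ (m : Fin M) (i : Fin K), τ ≤ Nat.card {t : Fin T // a m t = i}

/-- What is observed in `M` episodes of length `T`: the pulled arm and the (binary) reward of every
round of every episode. -/
abbrev History (K M T : ℕ) : Type := Fin M → Fin T → Fin K × Bool

/-- The law of the observations when the mean rewards in episode `m` are `μ m` and arm `a m t` is
pulled in round `t` of episode `m`: the rewards are independent, and the reward of that round is
Bernoulli with mean `μ m (a m t)`. -/
noncomputable def historyLaw {K M T : ℕ} (μ : Fin M → Fin K → unitInterval)
    (a : Fin M → Fin T → Fin K) : Measure (History K M T) :=
  Measure.pi fun m => Measure.pi fun t =>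
    ProbabilityTheory.bernoulliMeasure (a m t, true) (a m t, false) (μ m (a m t))

/-- `P[L̂ > L + ε] + P[L̂ < L]`. -/
noncomputable def errorProb {K M T : ℕ} (Lhat : History K M T → ℝ) (L ε : ℝ)
    (μ : Fin M → Fin K → unitInterval) (a : Fin M → Fin T → Fin K) : ℝ :=
  (historyLaw μ a).real {h | L + ε < Lhat h} + (historyLaw μ a).real {h | Lhat h < L}

/-- An estimator is given by a function `Lhat T` of the observations for every episode length `T`,
where `M T` episodes are observed. It is uniformly good for `(α, ε_α, τ, ε)` if its error is
`o(log T / T)` for every latent `L > 0`, every sequence `μ 0, μ 1, …` of instances in `Φ(L)` (of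
which the first `M T` are the observed tasks) and all choices of pulled arms such that learnability
and minimal exploration hold for all large `T`.

Only non-random choices of pulled arms are asked for. An estimator that is also good for adaptive
or random ones is in particular good in this sense, so that necessary conditions for being good in
this sense apply to it as well. For the same reason the instance `μ m` may not vary with `T`. -/
def UniformlyGood {D K : ℕ} (x : Fin K → EuclideanSpace ℝ (Fin D)) (α εα ε : ℝ) (τ M : ℕ → ℕ)
    (Lhat : ∀ T : ℕ, History K (M T) T → ℝ) : Prop :=
  ∀ (L : ℝ) (μ : ℕ → Fin K → unitInterval) (a : ∀ T : ℕ, Fin (M T) → Fin T → Fin K),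
    0 < L → (∀ m, μ m ∈ lipStructure x L) →
    (∀ᶠ T : ℕ in atTop,
      Learnable x α εα L (fun m : Fin (M T) => μ m) ∧ MinExploration (τ T) (a T)) →
    (fun T : ℕ => errorProb (Lhat T) L ε (fun m : Fin (M T) => μ m) (a T)) =o[atTop]
      (fun T : ℕ => Real.log T / T)

end LipschitzTransfer

/-!
The proof is a two-environment argument. In the base environment every arm has mean `(1 - g) / 2` in
every episode, so that the tightest Lipschitz constant is `0` and the latent constant may be any
`0 < δ ≤ ε_α`. In the other environment one arm `i₀` of a pair at distance `Δ_x` has mean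
`(1 + g) / 2` in `⌈α M⌉` of the first `M` episodes, where `g = (ε - ε_α + 2 δ) Δ_x`. This makes the
latent constant `ε + 2 δ` admissible, because the tightest constant in these episodes is at least
`g / Δ_x = (ε + 2 δ) - ε_α`. As `δ + ε < ε + 2 δ`, no value of `L̂` is right in both environments.

If `i₀` is pulled exactly `τ` times per episode, the squared Hellinger affinity of the two laws is
`(1 - g²) ^ (τ ⌈α M⌉)` (`affinity_historyLaw`), and by Le Cam's inequality (`affinity_sq_le`) it is
at most twice the sum of the two error probabilities, hence `o(log T / T)`. Taking logarithms gives
`τ ⌈α M⌉ g² ≥ (1 - g²) / 2 * log T` for large `T` (`log_le_of_uniformlyGood`), and a small `δ`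
replaces `g` by a multiple of `(ε - ε_α) Δ_x` (`log_le_mul_ceil`). The two conclusions come from
`⌈α M⌉ ≤ 2 α M` when `α M ≥ 1`, and from `⌈α M⌉ ≤ M` in general.
-/

namespace LipschitzTransfer

/-! ### Hellinger affinity on finite spaces -/

/-- The Hellinger affinity (Bhattacharyya coefficient) `∑ z, √(μ{z} ν{z})` of two measures on a
finite space. -/
noncomputable def affinity {X : Type*} [Fintype X] [MeasurableSpace X] (μ ν : Measure X) : ℝ :=
  ∑ z, √(μ.real {z}) * √(ν.real {z})

/-- Le Cam's inequality: two laws of large affinity cannot be told apart by any test `s`. -/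
lemma affinity_sq_le {X : Type*} [Fintype X] [MeasurableSpace X] [MeasurableSingletonClass X]
    (μ ν : Measure X) [IsProbabilityMeasure μ] [IsProbabilityMeasure ν] (s : Set X) :
    affinity μ ν ^ 2 ≤ 2 * (μ.real s + ν.real sᶜ) := by
  classical
  have key (t : Finset X) :
      ∑ z ∈ t, √(μ.real {z}) * √(ν.real {z}) ≤ √(μ.real t) * √(ν.real t) := by
    rw [← sum_measureReal_singleton, ← sum_measureReal_singleton]
    exact Real.sum_sqrt_mul_sqrt_le t (fun _ => measureReal_nonneg) (fun _ => measureReal_nonneg)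
  have hs := key s.toFinset
  have hc := key s.toFinsetᶜ
  rw [Finset.coe_compl, Set.coe_toFinset] at hc
  rw [Set.coe_toFinset] at hs
  have h1 : ∑ z ∈ s.toFinset, √(μ.real {z}) * √(ν.real {z}) ≤ √(μ.real s) :=
    hs.trans (mul_le_of_le_one_right (Real.sqrt_nonneg _)
      (Real.sqrt_le_one.mpr measureReal_le_one))
  have h2 : ∑ z ∈ s.toFinsetᶜ, √(μ.real {z}) * √(ν.real {z}) ≤ √(ν.real sᶜ) :=
    hc.trans (mul_le_of_le_one_left (Real.sqrt_nonneg _)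
      (Real.sqrt_le_one.mpr measureReal_le_one))
  have h3 : affinity μ ν ≤ √(μ.real s) + √(ν.real sᶜ) := by
    rw [affinity, ← Finset.sum_add_sum_compl s.toFinset]
    exact add_le_add h1 h2
  have h0 : 0 ≤ affinity μ ν := Finset.sum_nonneg fun _ _ => by positivity
  have e1 := Real.sq_sqrt (measureReal_nonneg (μ := μ) (s := s))
  have e2 := Real.sq_sqrt (measureReal_nonneg (μ := ν) (s := sᶜ))
  nlinarith [pow_le_pow_left₀ h0 h3 2, sq_nonneg (√(μ.real s) - √(ν.real sᶜ))]

lemma affinity_self {X : Type*} [Fintype X] [MeasurableSpace X] [MeasurableSingletonClass X]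
    (μ : Measure X) [IsProbabilityMeasure μ] : affinity μ μ = 1 := by
  simp only [affinity, Real.mul_self_sqrt measureReal_nonneg]
  simp

lemma affinity_pi {ι : Type*} [Fintype ι] [DecidableEq ι] {X : ι → Type*} [∀ i, Fintype (X i)]
    [∀ i, MeasurableSpace (X i)] (μ ν : ∀ i, Measure (X i))
    [∀ i, IsProbabilityMeasure (μ i)] [∀ i, IsProbabilityMeasure (ν i)] :
    affinity (Measure.pi μ) (Measure.pi ν) = ∏ i, affinity (μ i) (ν i) := by
  simp only [affinity, Fintype.prod_sum, measureReal_def, Measure.pi_singleton, ENNReal.toReal_prod]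
  refine Finset.sum_congr rfl fun z _ => ?_
  rw [Finset.prod_mul_distrib, Real.sqrt_prod _ fun _ _ => ENNReal.toReal_nonneg,
    Real.sqrt_prod _ fun _ _ => ENNReal.toReal_nonneg]

lemma affinity_bernoulliMeasure {X : Type*} [Fintype X] [MeasurableSpace X]
    [MeasurableSingletonClass X] {x y : X} (hxy : x ≠ y) (p q : unitInterval) :
    affinity (ProbabilityTheory.bernoulliMeasure x y p)
      (ProbabilityTheory.bernoulliMeasure x y q) =
      √(p : ℝ) * √(q : ℝ) + √(1 - p : ℝ) * √(1 - q : ℝ) := by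
  rw [affinity, Fintype.sum_eq_add x y hxy]
  · simp [hxy, hxy.symm]
  · rintro z ⟨hx, hy⟩
    simp [hx.symm, hy.symm]

lemma affinity_bernoulliMeasure_symm {X : Type*} [Fintype X] [MeasurableSpace X]
    [MeasurableSingletonClass X] {x y : X} (hxy : x ≠ y) {p q : unitInterval} {g : ℝ}
    (hg1 : g ≤ 1) (hp : (p : ℝ) = (1 - g) / 2) (hq : (q : ℝ) = (1 + g) / 2) :
    affinity (ProbabilityTheory.bernoulliMeasure x y p)
      (ProbabilityTheory.bernoulliMeasure x y q) = √(1 - g ^ 2) := by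
  have h1 : (1 - (1 - g) / 2 : ℝ) = (1 + g) / 2 := by ring
  have h2 : (1 - (1 + g) / 2 : ℝ) = (1 - g) / 2 := by ring
  have h3 : √(1 - g ^ 2) = 2 * √((1 - g) / 2 * ((1 + g) / 2)) := by
    rw [show (1 - g ^ 2 : ℝ) = 2 ^ 2 * ((1 - g) / 2 * ((1 + g) / 2)) by ring,
      Real.sqrt_mul (by norm_num), Real.sqrt_sq (by norm_num)]
  rw [affinity_bernoulliMeasure hxy, hp, hq, h1, h2, h3, Real.sqrt_mul (by linarith)]
  ring

instance {K M T : ℕ} (μ : Fin M → Fin K → unitInterval) (a : Fin M → Fin T → Fin K) :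
    IsProbabilityMeasure (historyLaw μ a) := by
  unfold historyLaw
  infer_instance

/-- If two environments agree except that arm `i₀` has mean `(1 - g) / 2` in one and
`(1 + g) / 2` in the other in the episodes of `S`, each of which pulls `i₀` exactly `n` times, then
each of these `n * #S` pulls multiplies the affinity by `√(1 - g²)`. -/
lemma affinity_historyLaw {K M T : ℕ} {μ ν : Fin M → Fin K → unitInterval}
    {a : Fin M → Fin T → Fin K} {i₀ : Fin K} {S : Finset (Fin M)} {n : ℕ} {g : ℝ}
    (hg0 : 0 ≤ g) (hg1 : g ≤ 1)
    (hn : ∀ m, Nat.card {t : Fin T // a m t = i₀} = n)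
    (hμ : ∀ m ∈ S, (μ m i₀ : ℝ) = (1 - g) / 2) (hν : ∀ m ∈ S, (ν m i₀ : ℝ) = (1 + g) / 2)
    (heq : ∀ m i, ¬(m ∈ S ∧ i = i₀) → μ m i = ν m i) :
    affinity (historyLaw μ a) (historyLaw ν a) ^ 2 = (1 - g ^ 2) ^ (n * S.card) := by
  have hround (m : Fin M) (t : Fin T) :
      affinity (ProbabilityTheory.bernoulliMeasure (a m t, true) (a m t, false) (μ m (a m t)))
        (ProbabilityTheory.bernoulliMeasure (a m t, true) (a m t, false) (ν m (a m t))) =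
        if m ∈ S then if a m t = i₀ then √(1 - g ^ 2) else 1 else 1 := by
    by_cases hm : m ∈ S
    · by_cases hi : a m t = i₀
      · rw [if_pos hm, if_pos hi]
        exact affinity_bernoulliMeasure_symm (by simp) hg1 (by rw [hi, hμ m hm])
          (by rw [hi, hν m hm])
      · rw [if_pos hm, if_neg hi, heq m _ fun h => hi h.2, affinity_self]
    · rw [if_neg hm, heq m _ fun h => hm h.1, affinity_self]
  have hepisode (m : Fin M) :
      ∏ t : Fin T, (if m ∈ S then if a m t = i₀ then √(1 - g ^ 2) else 1 else 1) =
        if m ∈ S then √(1 - g ^ 2) ^ n else 1 := by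
    split_ifs
    · rw [← hn m, Nat.card_eq_fintype_card, Fintype.card_subtype, Finset.prod_ite]
      simp
    · simp
  have hsq : √(1 - g ^ 2) ^ 2 = 1 - g ^ 2 := Real.sq_sqrt (by nlinarith)
  simp only [historyLaw, affinity_pi, hround, hepisode]
  rw [Finset.prod_ite]
  simp only [Finset.filter_mem_eq_inter, Finset.univ_inter, Finset.prod_const, one_pow, mul_one]
  conv_rhs => rw [← hsq]
  simp only [← pow_mul]
  congr 1
  ring

/-- An estimator cannot be accurate for two latent constants `L` and `L'` more than `ε` apart: the
events `{L + ε < L̂}` and `{L̂ < L'}` cover everything. -/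
lemma affinity_sq_le_errorProb {K M T : ℕ} (Lhat : History K M T → ℝ) {L L' ε : ℝ}
    (h : L + ε < L') (μ ν : Fin M → Fin K → unitInterval) (a : Fin M → Fin T → Fin K) :
    affinity (historyLaw μ a) (historyLaw ν a) ^ 2 ≤
      2 * (errorProb Lhat L ε μ a + errorProb Lhat L' ε ν a) := by
  refine (affinity_sq_le _ _ {z | L + ε < Lhat z}).trans ?_
  have h1 : (historyLaw ν a).real {z | L + ε < Lhat z}ᶜ ≤
      (historyLaw ν a).real {z | Lhat z < L'} :=
    measureReal_mono fun z hz => lt_of_le_of_lt (not_lt.mp (Set.mem_compl_iff _ _ |>.mp hz)) h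
  have h2 : 0 ≤ (historyLaw μ a).real {z | Lhat z < L} := measureReal_nonneg
  have h3 : 0 ≤ (historyLaw ν a).real {z | L' + ε < Lhat z} := measureReal_nonneg
  unfold errorProb
  linarith

/-! ### Choice of the pulled arms and of the perturbed episodes -/

/-- Pull the arms in turn until each has been pulled `τ` times, and `j` from then on. -/
def roundRobin {K : ℕ} (j : Fin K) (τ t : ℕ) : Fin K :=
  if t < K * τ then ⟨t % K, Nat.mod_lt _ j.pos⟩ else j

lemma le_card_roundRobin {K : ℕ} (i j : Fin K) {τ T : ℕ} (hT : K * τ ≤ T) :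
    τ ≤ Nat.card {t : Fin T // roundRobin j τ t = i} := by
  have hlt (s : Fin τ) : K * s + i < K * τ := by
    have h1 := i.isLt
    have h2 : K * ((s : ℕ) + 1) ≤ K * τ := Nat.mul_le_mul_left _ s.isLt
    linarith
  let f : Fin τ → {t : Fin T // roundRobin j τ t = i} := fun s =>
    ⟨⟨K * s + i, (hlt s).trans_le hT⟩, by
      simp [roundRobin, hlt s, Nat.mod_eq_of_lt i.isLt]⟩
  have hf : Function.Injective f := fun s s' h => by
    have h1 : K * (s : ℕ) + i = K * s' + i := congrArg (fun t => (t.1 : ℕ)) h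
    exact Fin.ext (Nat.eq_of_mul_eq_mul_left i.pos (Nat.add_right_cancel h1))
  simpa using Nat.card_le_card_of_injective f hf

lemma card_roundRobin {K : ℕ} {i j : Fin K} (hij : i ≠ j) {τ T : ℕ} (hT : K * τ ≤ T) :
    Nat.card {t : Fin T // roundRobin j τ t = i} = τ := by
  refine le_antisymm ?_ (le_card_roundRobin i j hT)
  have hspec (t : {t : Fin T // roundRobin j τ t = i}) :
      (t.1 : ℕ) < K * τ ∧ (t.1 : ℕ) % K = i := by
    obtain ⟨t, ht⟩ := t
    unfold roundRobin at ht
    split_ifs at ht with h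
    · exact ⟨h, congrArg Fin.val ht⟩
    · exact absurd ht.symm hij
  let f : {t : Fin T // roundRobin j τ t = i} → Fin τ := fun t =>
    ⟨(t.1 : ℕ) / K, Nat.div_lt_of_lt_mul (hspec t).1⟩
  have hf : Function.Injective f := fun t t' h => by
    have h1 : (t.1 : ℕ) / K = (t'.1 : ℕ) / K := congrArg Fin.val h
    apply Subtype.ext
    apply Fin.ext
    rw [← Nat.div_add_mod (t.1 : ℕ) K, ← Nat.div_add_mod (t'.1 : ℕ) K, h1, (hspec t).2,
      (hspec t').2]
  simpa using Nat.card_le_card_of_injective f hf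

/-- Selecting the indices at which `⌈α m⌉` increases gives, in every prefix of length `M`, the least
number of indices that is at least `α M`. -/
lemma card_filter_ceil {α : ℝ} (h0 : 0 ≤ α) (h1 : α ≤ 1) (M : ℕ) :
    (Finset.univ.filter fun m : Fin M => ⌈α * (m : ℕ)⌉₊ < ⌈α * ((m : ℕ) + 1)⌉₊).card =
      ⌈α * M⌉₊ := by
  rw [Finset.card_filter,
    Fin.sum_univ_eq_sum_range (fun m : ℕ => if ⌈α * m⌉₊ < ⌈α * (m + 1)⌉₊ then 1 else 0) M]
  induction M with
  | zero => simp
  | succ n ih =>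
    rw [Finset.sum_range_succ, ih]
    push_cast
    have hmono : ⌈α * n⌉₊ ≤ ⌈α * (n + 1)⌉₊ := Nat.ceil_mono (by nlinarith)
    have hstep : ⌈α * (n + 1)⌉₊ ≤ ⌈α * n⌉₊ + 1 := by
      rw [← Nat.ceil_add_one (by positivity)]
      exact Nat.ceil_mono (by nlinarith)
    split_ifs <;> omega

/-! ### Lipschitz constants -/

section
variable {D K : ℕ} {x : Fin K → EuclideanSpace ℝ (Fin D)}

lemma minDist_le {i j : Fin K} (hij : i ≠ j) : minDist x ≤ ‖x i - x j‖ :=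
  ciInf_le (Set.finite_range _).bddBelow
    (⟨(i, j), hij⟩ : {p : Fin K × Fin K // p.1 ≠ p.2})

lemma exists_minDist_eq (hK : 2 ≤ K) : ∃ i j, i ≠ j ∧ ‖x i - x j‖ = minDist x := by
  have : Nonempty {p : Fin K × Fin K // p.1 ≠ p.2} :=
    ⟨⟨(⟨0, by omega⟩, ⟨1, by omega⟩), by simp⟩⟩
  obtain ⟨⟨⟨i, j⟩, hij⟩, h⟩ := exists_eq_ciInf_of_finite
    (f := fun p : {p : Fin K × Fin K // p.1 ≠ p.2} => ‖x p.1.1 - x p.1.2‖)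
  exact ⟨i, j, hij, h⟩

lemma tightLip_nonneg (μ : Fin K → unitInterval) : 0 ≤ tightLip x μ :=
  Real.iSup_nonneg fun _ => by positivity

lemma le_tightLip (μ : Fin K → unitInterval) {i j : Fin K} (hij : i ≠ j) :
    |(μ i : ℝ) - μ j| / ‖x i - x j‖ ≤ tightLip x μ :=
  le_ciSup (f := fun p : {p : Fin K × Fin K // p.1 ≠ p.2} =>
    |(μ p.1.1 : ℝ) - (μ p.1.2 : ℝ)| / ‖x p.1.1 - x p.1.2‖) (Set.finite_range _).bddAbove
    ⟨(i, j), hij⟩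

/-- Means that differ by at most `g` vary at rate at most `L` as soon as `g ≤ L Δ_x`. -/
lemma mem_lipStructure_of_abs_le {μ : Fin K → unitInterval} {g L : ℝ} (hL : 0 ≤ L)
    (hg : g ≤ L * minDist x) (h : ∀ i j, |(μ i : ℝ) - μ j| ≤ g) : μ ∈ lipStructure x L := by
  intro i j
  rcases eq_or_ne i j with rfl | hij
  · simp
  · exact (h i j).trans (hg.trans (mul_le_mul_of_nonneg_left (minDist_le hij) hL))

end

/-! ### The lower bound -/

/-- The two-environment bound with the gap `g` explicit: an estimator that is uniformly good must
gather information at least `log T / 2`, where each of the `τ ⌈α M⌉` pulls of the perturbed arm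
carries `-log (1 - g²) ≤ g² / (1 - g²)`. The factor `1 / 2` absorbs `log T / T = O(T ^ (-1 / 2))`. -/
lemma log_le_of_uniformlyGood {D K : ℕ} {x : Fin K → EuclideanSpace ℝ (Fin D)} {α εα ε δ g : ℝ}
    {τ M : ℕ → ℕ} {Lhat : ∀ T : ℕ, History K (M T) T → ℝ} (hK : 2 ≤ K)
    (hx : Function.Injective x) (hα : 0 < α) (hα1 : α ≤ 1) (hεα : 0 < εα) (hε : εα < ε)
    (hτ : ∀ᶠ T : ℕ in atTop, K * τ T ≤ T) (hgood : UniformlyGood x α εα ε τ M Lhat)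
    (hδ : 0 < δ) (hδε : δ ≤ εα) (hg : g = (ε - εα + 2 * δ) * minDist x) (hg1 : g < 1) :
    ∀ᶠ T : ℕ in atTop, (1 - g ^ 2) / 2 * Real.log T ≤ g ^ 2 * τ T * ⌈α * M T⌉₊ := by
  classical
  obtain ⟨i₀, j₀, hij, hdist⟩ := exists_minDist_eq (x := x) hK
  have hΔ : 0 < minDist x := by
    rw [← hdist]
    exact norm_pos_iff.mpr (sub_ne_zero.mpr (hx.ne hij))
  have hg0 : 0 < g := by rw [hg]; exact mul_pos (by linarith) hΔ
  let p : unitInterval := ⟨(1 - g) / 2, by linarith, by linarith⟩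
  let q : unitInterval := ⟨(1 + g) / 2, by linarith, by linarith⟩
  let P : ℕ → Prop := fun m => ⌈α * m⌉₊ < ⌈α * (m + 1)⌉₊
  -- The base environment is constant, hence learnable with any latent constant up to `εα`; the
  -- perturbed one moves arm `i₀` in the least possible number of episodes.
  let μ : ℕ → Fin K → unitInterval := fun _ _ => p
  let ν : ℕ → Fin K → unitInterval := fun m i => if P m ∧ i = i₀ then q else p
  let a : ∀ T : ℕ, Fin (M T) → Fin T → Fin K := fun T _ t => roundRobin j₀ (τ T) t
  have hμLip (m : ℕ) : μ m ∈ lipStructure x δ := by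
    intro i j
    simp only [μ, sub_self, abs_zero]
    positivity
  have hνLip (m : ℕ) : ν m ∈ lipStructure x (ε + 2 * δ) := by
    refine mem_lipStructure_of_abs_le (g := g) (by linarith) ?_ fun i j => ?_
    · rw [hg]
      exact mul_le_mul_of_nonneg_right (by linarith) hΔ.le
    · simp only [ν]
      split_ifs <;> simp only [p, q, abs_le] <;> constructor <;> linarith
  have hμLearn (T : ℕ) : Learnable x α εα δ (fun m : Fin (M T) => μ m) := by
    have h : ∀ m : Fin (M T), δ - εα ≤ tightLip x (μ m) := fun m =>
      (sub_nonpos.mpr hδε).trans (tightLip_nonneg _)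
    have h' : Nat.card {m : Fin (M T) // δ - εα ≤ tightLip x (μ m)} = M T := by
      simp [Nat.card_eq_fintype_card, Fintype.card_subtype, h]
    rw [Learnable, h']
    exact mul_le_of_le_one_left (Nat.cast_nonneg _) hα1
  have hνLearn (T : ℕ) : Learnable x α εα (ε + 2 * δ) (fun m : Fin (M T) => ν m) := by
    have h : ∀ m : Fin (M T), P m → ε + 2 * δ - εα ≤ tightLip x (ν m) := fun m hm => by
      refine le_trans ?_ (le_tightLip (ν m) hij)
      rw [hdist, le_div_iff₀ hΔ]
      simp only [ν, hm, hij.symm, true_and, and_false, if_true, if_false, p, q]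
      refine le_trans (le_of_eq ?_) (le_abs_self _)
      rw [show (1 + g) / 2 - (1 - g) / 2 = g by ring, hg]
      ring
    have hcard : ⌈α * M T⌉₊ ≤ Nat.card {m : Fin (M T) // ε + 2 * δ - εα ≤ tightLip x (ν m)} := by
      rw [← card_filter_ceil hα.le hα1, Nat.card_eq_fintype_card, Fintype.card_subtype]
      exact Finset.card_le_card fun m hm => by
        simpa using h m (by simpa [P] using hm)
    exact (Nat.le_ceil _).trans (by exact_mod_cast hcard)
  have hExpl : ∀ᶠ T : ℕ in atTop, MinExploration (τ T) (a T) :=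
    hτ.mono fun T hT m i => le_card_roundRobin i j₀ hT
  have hμgood := hgood δ μ a hδ hμLip (hExpl.mono fun T hT => ⟨hμLearn T, hT⟩)
  have hνgood := hgood (ε + 2 * δ) ν a (by linarith) hνLip
    (hExpl.mono fun T hT => ⟨hνLearn T, hT⟩)
  have hlog : (fun T : ℕ => Real.log T) =O[atTop] fun T : ℕ => (T : ℝ) ^ (1 / 2 : ℝ) :=
    ((isLittleO_log_rpow_atTop (by norm_num : (0 : ℝ) < 1 / 2)).comp_tendsto
      tendsto_natCast_atTop_atTop).isBigO
  have hrate : (fun T : ℕ => Real.log T / T) =O[atTop] fun T : ℕ => (T : ℝ) ^ (1 / 2 : ℝ) / T := by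
    simpa only [div_eq_mul_inv] using hlog.mul (Asymptotics.isBigO_refl _ _)
  have hsum := ((hμgood.add hνgood).trans_isBigO hrate).bound (by norm_num : (0 : ℝ) < 1 / 2)
  filter_upwards [hsum, hτ, eventually_ge_atTop 1] with T hT hτT hT1
  have hTpos : (0 : ℝ) < T := by exact_mod_cast hT1
  have hsqrt : (T : ℝ) ^ (1 / 2 : ℝ) / T = (T : ℝ) ^ (-(1 / 2) : ℝ) := by
    rw [← Real.rpow_sub_one hTpos.ne']
    norm_num
  have haff := affinity_historyLaw (μ := fun m : Fin (M T) => μ m) (ν := fun m => ν m) (a := a T)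
    (i₀ := i₀) (S := Finset.univ.filter fun m : Fin (M T) => P m) (n := τ T) (g := g) hg0.le hg1.le
    (fun m => card_roundRobin hij hτT) (fun m _ => rfl)
    (fun m hm => by
      have hm' : P m := (Finset.mem_filter.mp hm).2
      simp [ν, hm', q])
    (fun m i h => by
      have h' : ¬(P m ∧ i = i₀) := by simpa using h
      simp [ν, h', μ])
  have hle := affinity_sq_le_errorProb (Lhat T) (by linarith : δ + ε < ε + 2 * δ)
    (fun m : Fin (M T) => μ m) (fun m => ν m) (a T)
  rw [haff, card_filter_ceil hα.le hα1] at hle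
  have h1g : 0 < 1 - g ^ 2 := by nlinarith
  have hpow : (1 - g ^ 2) ^ (τ T * ⌈α * M T⌉₊) ≤ (T : ℝ) ^ (-(1 / 2) : ℝ) := by
    rw [hsqrt, Real.norm_of_nonneg (Real.rpow_nonneg hTpos.le _)] at hT
    have := (Real.le_norm_self _).trans hT
    linarith
  have hlogle := Real.log_le_log (by positivity) hpow
  rw [Real.log_pow, Real.log_rpow hTpos] at hlogle
  have hinv := Real.one_sub_inv_le_log_of_pos h1g
  have hN : (0 : ℝ) ≤ ((τ T * ⌈α * M T⌉₊ : ℕ) : ℝ) := Nat.cast_nonneg _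
  have h4 := (mul_le_mul_of_nonneg_left hinv hN).trans hlogle
  have h5 : (1 - g ^ 2) * (1 - (1 - g ^ 2)⁻¹) = -g ^ 2 := by
    field_simp
    ring
  have h6 := mul_le_mul_of_nonneg_left h4 h1g.le
  rw [mul_left_comm, h5] at h6
  push_cast at h6
  linarith

/-- The bound with `⌈α M⌉` in place of `α M`. -/
lemma log_le_mul_ceil {η₀ : ℝ} (hη : η₀ < 1) {D K : ℕ}
    {x : Fin K → EuclideanSpace ℝ (Fin D)} {α εα ε : ℝ}
    {τ M : ℕ → ℕ} {Lhat : ∀ T : ℕ, History K (M T) T → ℝ} (hK : 2 ≤ K)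
    (hx : Function.Injective x) (hα : 0 < α) (hα1 : α ≤ 1) (hεα : 0 < εα) (hε : εα < ε)
    (hη₀ : (ε - εα) * minDist x ≤ η₀)
    (hτ : ∀ᶠ T : ℕ in atTop, K * τ T ≤ T) (hgood : UniformlyGood x α εα ε τ M Lhat) :
    ∀ᶠ T : ℕ in atTop, (1 - η₀) / 16 * Real.log T ≤
      minDist x ^ 2 * (ε - εα) ^ 2 * τ T * ⌈α * M T⌉₊ := by
  have hΔ : 0 < minDist x := by
    obtain ⟨i, j, hij, h⟩ := exists_minDist_eq (x := x) hK
    rw [← h]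
    exact norm_pos_iff.mpr (sub_ne_zero.mpr (hx.ne hij))
  -- `δ` is so small that `g ≤ 2 (ε - εα) Δ_x` and `g ≤ (1 + η₀) / 2`.
  obtain ⟨δ, hδ, h1, h2, h3⟩ : ∃ δ : ℝ, 0 < δ ∧ δ ≤ εα ∧ δ ≤ (ε - εα) / 2 ∧
      δ ≤ (1 - η₀) / (4 * minDist x) :=
    ⟨min εα (min ((ε - εα) / 2) ((1 - η₀) / (4 * minDist x))),
      lt_min hεα (lt_min (by linarith) (div_pos (by linarith) (by linarith))), min_le_left _ _,
      (min_le_right _ _).trans (min_le_left _ _), (min_le_right _ _).trans (min_le_right _ _)⟩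
  rw [le_div_iff₀ (by positivity)] at h3
  obtain ⟨g, hg⟩ : ∃ g, g = (ε - εα + 2 * δ) * minDist x := ⟨_, rfl⟩
  have hg0 : 0 ≤ g := by rw [hg]; exact mul_nonneg (by linarith) hΔ.le
  have hgη : g ≤ (1 + η₀) / 2 := by rw [hg]; linarith
  have hg2 : g ≤ 2 * ((ε - εα) * minDist x) := by rw [hg]; nlinarith
  have hgsq : g ^ 2 ≤ 4 * (minDist x ^ 2 * (ε - εα) ^ 2) :=
    (pow_le_pow_left₀ hg0 hg2 2).trans (le_of_eq (by ring))
  have h1g : (1 - η₀) / 2 ≤ 1 - g ^ 2 := by nlinarith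
  filter_upwards [log_le_of_uniformlyGood hK hx hα hα1 hεα hε hτ hgood hδ h1 hg (by linarith)]
    with T hT
  have hl : 0 ≤ Real.log T := Real.log_natCast_nonneg T
  have hN : (0 : ℝ) ≤ τ T * ⌈α * M T⌉₊ := by positivity
  have h5 := mul_le_mul_of_nonneg_right hgsq hN
  have h6 := mul_le_mul_of_nonneg_right h1g hl
  linarith

end LipschitzTransfer

theorem theorem5 :
    ∀ η₀ : ℝ, η₀ < 1 → ∃ c : ℝ, 0 < c ∧
      ∀ (D K : ℕ) (x : Fin K → EuclideanSpace ℝ (Fin D)) (α εα ε : ℝ) (τ M : ℕ → ℕ)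
        (Lhat : ∀ T : ℕ, LipschitzTransfer.History K (M T) T → ℝ),
        2 ≤ K → Function.Injective x → (∀ i k, x i k ∈ Set.Icc (0 : ℝ) 1) →
        0 < α → α ≤ 1 → 0 < εα → εα < ε →
        (ε - εα) * LipschitzTransfer.minDist x ≤ η₀ →
        (∀ T, 0 < τ T) → (∀ᶠ T : ℕ in atTop, K * τ T ≤ T) →
        LipschitzTransfer.UniformlyGood x α εα ε τ M Lhat →
        ((BddAbove (Set.range τ) ∨ ∀ᶠ T : ℕ in atTop, 1 ≤ α * (M T : ℝ)) →
          ∀ᶠ T : ℕ in atTop, c * Real.log T ≤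
            LipschitzTransfer.minDist x ^ 2 * (ε - εα) ^ 2 * α * (τ T : ℝ) * (M T : ℝ)) ∧
        (∀ᶠ T : ℕ in atTop, c * α * Real.log T ≤
            LipschitzTransfer.minDist x ^ 2 * (ε - εα) ^ 2 * α * (τ T : ℝ) * (M T : ℝ)) := by
  intro η₀ hη
  refine ⟨(1 - η₀) / 32, by linarith, ?_⟩
  intro D K x α εα ε τ M Lhat hK hx _ hα hα1 hεα hε hη₀ _ hτ hgood
  have key := LipschitzTransfer.log_le_mul_ceil hη hK hx hα hα1 hεα hε hη₀ hτ hgood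
  set Δ := LipschitzTransfer.minDist x
  refine ⟨fun hprov => ?_, ?_⟩
  · have hone : ∀ᶠ T : ℕ in atTop, 1 ≤ α * (M T : ℝ) := by
      refine hprov.elim (fun ⟨B, hB⟩ => ?_) id
      -- With `τ` bounded, the bound forces `⌈α M⌉` to exceed `1`.
      have hinf : Tendsto (fun T : ℕ => (1 - η₀) / 16 * Real.log T) atTop atTop :=
        (Real.tendsto_log_atTop.comp tendsto_natCast_atTop_atTop).const_mul_atTop (by linarith)
      filter_upwards [key, hinf.eventually_gt_atTop (Δ ^ 2 * (ε - εα) ^ 2 * B)] with T hT hB'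
      by_contra! hlt
      have hceil : (⌈α * M T⌉₊ : ℝ) ≤ 1 := by
        exact_mod_cast Nat.ceil_le.mpr (by simpa using hlt.le)
      have hτB : (τ T : ℝ) ≤ B := by exact_mod_cast hB ⟨T, rfl⟩
      have h1 : Δ ^ 2 * (ε - εα) ^ 2 * τ T * ⌈α * M T⌉₊ ≤ Δ ^ 2 * (ε - εα) ^ 2 * τ T :=
        mul_le_of_le_one_right (by positivity) hceil
      have h2 : Δ ^ 2 * (ε - εα) ^ 2 * τ T ≤ Δ ^ 2 * (ε - εα) ^ 2 * B :=
        mul_le_mul_of_nonneg_left hτB (by positivity)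
      linarith
    filter_upwards [key, hone] with T hT h1
    have hceil : (⌈α * M T⌉₊ : ℝ) ≤ 2 * (α * M T) := by
      linarith [Nat.ceil_lt_add_one (by positivity : 0 ≤ α * (M T : ℝ))]
    have h2 := mul_le_mul_of_nonneg_left hceil
      (by positivity : 0 ≤ Δ ^ 2 * (ε - εα) ^ 2 * (τ T : ℝ))
    linarith
  · filter_upwards [key] with T hT
    have hceil : (⌈α * M T⌉₊ : ℝ) ≤ M T := by
      exact_mod_cast Nat.ceil_le.mpr (mul_le_of_le_one_left (Nat.cast_nonneg _) hα1)
    have h2 := mul_le_mul_of_nonneg_left hceil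
      (by positivity : 0 ≤ Δ ^ 2 * (ε - εα) ^ 2 * (τ T : ℝ))
    have h3 := mul_le_mul_of_nonneg_left (hT.trans h2) hα.le
    have h4 : 0 ≤ (1 - η₀) / 16 * α * Real.log T :=
      mul_nonneg (mul_nonneg (by linarith) hα.le) (Real.log_natCast_nonneg T)
    linarith
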